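/- **Lemma (generalized non-commutative Hölder inequality).** Let $L$ be a natural number and let $A_1,\dots,A_L$ be a composable sequence of (not necessarily square) complex matrices, $A_i\in M(m_i\times n_i,\mathbb C)$ with $m_i=n_{i+1}$ for $1\le i<L$, and let $B=A_L\cdots A_1$. Let $p_1,\dots,p_L,r>0$ be real numbers with $\sum_{i=1}^L \frac1{p_i}=\frac1r$ (so that $L\ge 1$). For a complex matrix $A$ write $|A|:=\sqrt{A^*A}$, a positive semidefinite square matrix, and let $|A|^p$ (for $p>0$) be its $p$-th power in the sense of the functional calculus: if $|A|=U\,\mathrm{diag}(\lambda_j)\,U^*$ with $U$ unitary, then $|A|^p=U\,\mathrm{diag}(\lambda_j^p)\,U^*$. A *compatible family of matrix norms* is a function $|||\cdot|||$ assigning to every complex matrix of any finite size a nonnegative real number such that (i) its restriction to $M(m\times n,\mathbb C)$ is a norm on that complex vector space for all $m,n\in\mathbb N$, and (ii) whenever $m'\ge m$ and $n'\ge n$, every $A\in M(m\times n,\mathbb C)$ satisfies $|||\iota(A)|||=|||A|||$, where $\iota(A)=\begin{bmatrix}A&0\\0&0\end{bmatrix}\in M(m'\times n',\mathbb C)$.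 It is *unitary invariant* if $|||UAV^T|||=|||A|||$ for all $A\in M(m\times n,\mathbb C)$ and all unitary $U\in U(m)$, $V\in U(n)$. 1. For every unitary invariant compatible family of matrix norms $|||\cdot|||$, $$\bigl|\bigl|\bigl|\,|B|^r\,\bigr|\bigr|\bigr|^{1/r}\;\le\;\prod_{i=1}^L \bigl|\bigl|\bigl|\,|A_i|^{p_i}\,\bigr|\bigr|\bigr|^{1/p_i}.$$ 2. For the Schatten (quasi-)norms $\|A\|_p^S:=\bigl(\sum_{i=1}^{\min\{m,n\}} s_i(A)^p\bigr)^{1/p}$, where $p>0$ and $s_1(A),\dots,s_{\min\{m,n\}}(A)\ge 0$ are the singular values of $A\in M(m\times n,\mathbb C)$ listed with multiplicity, $$\|B\|_r^S\;\le\;\prod_{i=1}^L\|A_i\|_{p_i}^S .$$ -/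

import Mathlib

open scoped Matrix MatrixOrder

noncomputable section

namespace MatrixHolder

/-- The product `A_L ⋯ A_1` of a composable sequence of rectangular complex matrices. The matrix
written `A_{i+1}` in mathematics is `A i`, and it has `d (i+1)` rows and `d i` columns. -/
def chainProd : (L : ℕ) → (d : Fin (L + 1) → ℕ) →
    ((i : Fin L) → Matrix (Fin (d i.succ)) (Fin (d i.castSucc)) ℂ) →
    Matrix (Fin (d (Fin.last L))) (Fin (d 0)) ℂ
  | 0, d, _ => (1 : Matrix (Fin (d 0)) (Fin (d 0)) ℂ)
  | L + 1, d, A => A (Fin.last L) * chainProd L (fun i => d i.castSucc) (fun i => A i.castSucc)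

/-- The polar part `|A| = √(A^* A)` of a rectangular complex matrix. -/
def polarPart {m n : ℕ} (A : Matrix (Fin m) (Fin n) ℂ) : Matrix (Fin n) (Fin n) ℂ :=
  CFC.sqrt (Aᴴ * A)

/-- The matrix `|A| ^ p` for a real exponent `p`, in the sense of the functional calculus. -/
def polarPow {m n : ℕ} (A : Matrix (Fin m) (Fin n) ℂ) (p : ℝ) : Matrix (Fin n) (Fin n) ℂ :=
  CFC.rpow (polarPart A) p

/-- The upper left block inclusion `A ↦ [A 0; 0 0]` of `m × n` matrices into `m' × n'` matrices
(used for `m ≤ m'` and `n ≤ n'`). -/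
def blockIncl {m n : ℕ} (m' n' : ℕ) (A : Matrix (Fin m) (Fin n) ℂ) :
    Matrix (Fin m') (Fin n') ℂ :=
  Matrix.of fun i j =>
    if h : (i : ℕ) < m ∧ (j : ℕ) < n then A ⟨i, h.1⟩ ⟨j, h.2⟩ else 0

/-- A real-valued function on all complex matrices of all finite sizes. -/
abbrev MatrixFunctionFamily : Type := (m n : ℕ) → Matrix (Fin m) (Fin n) ℂ → ℝ

/-- A compatible family of matrix norms: a norm on each space of `m × n` complex matrices,
unchanged by the upper left block inclusions. -/
structure IsCompatibleNormFamily (N : MatrixFunctionFamily) : Prop where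
  nonneg : ∀ (m n : ℕ) (A : Matrix (Fin m) (Fin n) ℂ), 0 ≤ N m n A
  eq_zero_iff : ∀ (m n : ℕ) (A : Matrix (Fin m) (Fin n) ℂ), N m n A = 0 ↔ A = 0
  smul : ∀ (m n : ℕ) (c : ℂ) (A : Matrix (Fin m) (Fin n) ℂ), N m n (c • A) = ‖c‖ * N m n A
  add_le : ∀ (m n : ℕ) (A B : Matrix (Fin m) (Fin n) ℂ), N m n (A + B) ≤ N m n A + N m n B
  blockIncl_eq : ∀ (m n m' n' : ℕ) (A : Matrix (Fin m) (Fin n) ℂ), m ≤ m' → n ≤ n' →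
    N m' n' (blockIncl m' n' A) = N m n A

/-- Unitary invariance: `N (U A Vᵀ) = N A` for all unitary `U`, `V`. -/
def IsUnitaryInvariant (N : MatrixFunctionFamily) : Prop :=
  ∀ (m n : ℕ) (A : Matrix (Fin m) (Fin n) ℂ) (U : Matrix (Fin m) (Fin m) ℂ)
    (V : Matrix (Fin n) (Fin n) ℂ), U ∈ Matrix.unitaryGroup (Fin m) ℂ →
    V ∈ Matrix.unitaryGroup (Fin n) ℂ → N m n (U * A * Vᵀ) = N m n A

/-- The Schatten `p`-(quasi-)norm `(∑_{i < min m n} s_i(A) ^ p) ^ (1 / p)`, where `s_i(A)` are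
the singular values of `A`, listed with multiplicity. -/
def schattenNorm {m n : ℕ} (p : ℝ) (A : Matrix (Fin m) (Fin n) ℂ) : ℝ :=
  (∑ i ∈ Finset.range (min m n), (Matrix.toEuclideanLin A).singularValues i ^ p) ^ (1 / p)

end MatrixHolder

end

/-!
By Cauchy–Binet, `det ((A V)ᴴ (A V))` is at most the product of the `k` largest eigenvalues of
`Aᴴ A` times `det (Vᴴ V)` for every `V` with `k` columns, with equality when `V` consists of leading
eigenvectors. Iterating this bound along the product yields Horn's inequalities: the singular values
of `A_L ⋯ A_1` are weakly log-majorized by the entrywise products of those of the factors. A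
symmetric gauge `Φ` is monotone under weak log-majorization, since it is attained by a functional
with nonnegative weights, which may be rearranged to be decreasing, and `log t ≤ t - 1` together
with Abel summation then compares the weighted sums. Weighted AM–GM gives Hölder's inequality for
`Φ`. Finally, a unitarily invariant norm of `|A| ^ p` is a symmetric gauge of the `p`-th powers
of the singular values of `A`, which compatibility allows to be padded with zeros to a common
length; the Schatten case is the `ℓ¹` gauge.
-/

namespace MatrixHolder

section CauchyBinet

lemma prod_le_prod_range_card {R : Type*} [CommSemiring R] [PartialOrder R] [IsOrderedRing R]
    {D : ℕ → R} (hD : Antitone D) (hD0 : ∀ i, 0 ≤ D i) (s : Finset ℕ) :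
    ∏ i ∈ s, D i ≤ ∏ i ∈ Finset.range s.card, D i := by
  induction s using Finset.induction_on_max with
  | empty => simp
  | insert a s hs ih =>
    have ha : a ∉ s := fun h => (hs a h).false
    have hcard : s.card ≤ a := by
      simpa using Finset.card_le_card fun i hi => Finset.mem_range.mpr (hs i hi)
    rw [Finset.prod_insert ha, Finset.card_insert_of_notMem ha, Finset.prod_range_succ, mul_comm]
    exact mul_le_mul ih (hD hcard) (hD0 a) (Finset.prod_nonneg fun i _ => hD0 i)

variable {m n R : Type*} [Fintype m] [DecidableEq m] [Fintype n] [CommRing R]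

lemma det_mul_eq_sum_prod_mul_det_submatrix (M : Matrix m n R) (N : Matrix n m R) :
    (M * N).det = ∑ f : m → n, (∏ i, M i (f i)) * (N.submatrix f id).det := by
  classical
  have hrows : M * N = fun i => ∑ j, M i j • N j := by
    ext i l
    simp [Matrix.mul_apply, Finset.sum_apply]
  calc (M * N).det
      = Matrix.detRowAlternating.toMultilinearMap fun i => ∑ j, M i j • N j :=
        congrArg Matrix.det hrows
    _ = ∑ f : m → n, Matrix.detRowAlternating.toMultilinearMap fun i => M i (f i) • N (f i) :=
        MultilinearMap.map_sum _ _
    _ = ∑ f : m → n, (∏ i, M i (f i)) * (N.submatrix f id).det :=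
        Finset.sum_congr rfl fun f _ => MultilinearMap.map_smul_univ _ _ _

/-- The Cauchy–Binet formula. Summing over all maps `f : m → n` instead of all `m`-element subsets
of `n` counts every nonzero minor `(card m)!` times. -/
lemma factorial_mul_det_mul (M : Matrix m n R) (N : Matrix n m R) :
    ((Fintype.card m).factorial : R) * (M * N).det
      = ∑ f : m → n, (M.submatrix id f).det * (N.submatrix f id).det := by
  classical
  have permuted (σ : Equiv.Perm m) : (M * N).det
      = ∑ f : m → n, (Equiv.Perm.sign σ * ∏ i, M i (f (σ i))) * (N.submatrix f id).det := by
    rw [det_mul_eq_sum_prod_mul_det_submatrix,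
      ← Equiv.sum_comp (σ.arrowCongr (Equiv.refl n)).symm]
    refine Finset.sum_congr rfl fun f _ => ?_
    have hdet : (N.submatrix (f ∘ σ) id).det = Equiv.Perm.sign σ * (N.submatrix f id).det :=
      Matrix.det_permute σ (N.submatrix f id)
    change (∏ i, M i (f (σ i))) * (N.submatrix (f ∘ σ) id).det = _
    rw [hdet]
    ring
  calc ((Fintype.card m).factorial : R) * (M * N).det
      = ∑ _σ : Equiv.Perm m, (M * N).det := by simp [Fintype.card_perm]
    _ = ∑ f : m → n, ∑ σ : Equiv.Perm m,
          (Equiv.Perm.sign σ * ∏ i, M i (f (σ i))) * (N.submatrix f id).det := by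
        rw [Finset.sum_congr rfl fun σ _ => permuted σ, Finset.sum_comm]
    _ = ∑ f : m → n, (M.submatrix id f).det * (N.submatrix f id).det := by
        refine Finset.sum_congr rfl fun f _ => ?_
        rw [← Finset.sum_mul, ← (M.submatrix id f).det_transpose, (M.submatrix id f)ᵀ.det_apply']
        rfl

end CauchyBinet

section Determinant

variable {𝕜 m n κ : Type*} [RCLike 𝕜] [Fintype m] [Fintype n] [DecidableEq n]
  [Fintype κ] [DecidableEq κ]

lemma factorial_mul_det_conjTranspose_mul_diagonal_mul (D : n → ℝ) (W : Matrix n κ 𝕜) :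
    ((Fintype.card κ).factorial : 𝕜) * (Wᴴ * Matrix.diagonal (fun i => (D i : 𝕜)) * W).det
      = ((∑ f : κ → n, (∏ i, D (f i)) * ‖(W.submatrix f id).det‖ ^ 2 : ℝ) : 𝕜) := by
  rw [factorial_mul_det_mul, RCLike.ofReal_sum]
  refine Finset.sum_congr rfl fun f _ => ?_
  have hdet : ((Wᴴ * Matrix.diagonal (fun i => (D i : 𝕜))).submatrix id f).det
      = (∏ i, (D (f i) : 𝕜)) * star (W.submatrix f id).det := by
    rw [← Matrix.det_conjTranspose, ← Matrix.det_mul_row]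
    congr 1
    ext i j
    simp [mul_comm]
  rw [hdet, mul_assoc, ← starRingEnd_apply, RCLike.conj_mul]
  push_cast
  rfl

lemma norm_det_conjTranspose_mul_diagonal_mul_le {D : ℕ → ℝ} (hD : Antitone D)
    (hD0 : ∀ i, 0 ≤ D i) {e : n → ℕ} (he : Function.Injective e) (W : Matrix n κ 𝕜) :
    ‖(Wᴴ * Matrix.diagonal (fun i => (D (e i) : 𝕜)) * W).det‖
      ≤ (∏ i ∈ Finset.range (Fintype.card κ), D i) * ‖(Wᴴ * W).det‖ := by
  have hexpand (F : n → ℝ) (hF : ∀ i, 0 ≤ F i) :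
      ((Fintype.card κ).factorial : ℝ) * ‖(Wᴴ * Matrix.diagonal (fun i => (F i : 𝕜)) * W).det‖
        = ∑ f : κ → n, (∏ i, F (f i)) * ‖(W.submatrix f id).det‖ ^ 2 := by
    have h := congrArg norm (factorial_mul_det_conjTranspose_mul_diagonal_mul F W)
    rwa [norm_mul, RCLike.norm_natCast, RCLike.norm_of_nonneg (Finset.sum_nonneg fun f _ =>
      mul_nonneg (Finset.prod_nonneg fun i _ => hF _) (sq_nonneg _))] at h
  have hminor (f : κ → n) : (∏ i, D (e (f i))) * ‖(W.submatrix f id).det‖ ^ 2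
      ≤ (∏ i ∈ Finset.range (Fintype.card κ), D i) * ‖(W.submatrix f id).det‖ ^ 2 := by
    by_cases hf : Function.Injective f
    · refine mul_le_mul_of_nonneg_right ?_ (sq_nonneg _)
      simpa using prod_le_prod_range_card hD hD0 (Finset.univ.map ⟨e ∘ f, he.comp hf⟩)
    · obtain ⟨i, j, hij, hne⟩ := Function.not_injective_iff.mp hf
      have hzero : (W.submatrix f id).det = 0 :=
        Matrix.det_zero_of_row_eq hne (by ext l; simp [hij])
      simp [hzero]
  have hone := hexpand (fun _ => 1) fun _ => zero_le_one
  simp only [RCLike.ofReal_one, Matrix.diagonal_one, Matrix.mul_one, Finset.prod_const_one,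
    one_mul] at hone
  refine le_of_mul_le_mul_left ?_ (Nat.cast_pos.mpr (Fintype.card κ).factorial_pos : (0 : ℝ) < _)
  rw [hexpand _ fun i => hD0 _, mul_left_comm, hone, Finset.mul_sum]
  exact Finset.sum_le_sum fun f _ => hminor f

end Determinant

section SingularValues

variable {𝕜 m n : Type*} [RCLike 𝕜] [Fintype m] [Fintype n] [DecidableEq n]

/-- The singular values of a rectangular matrix, in decreasing order, with multiplicity, and
extended by zero to a sequence indexed by `ℕ`. -/
noncomputable abbrev singularValues (A : Matrix m n 𝕜) : ℕ → ℝ :=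
  (Matrix.toEuclideanLin A).singularValues

lemma singularValues_nonneg (A : Matrix m n 𝕜) (i : ℕ) : 0 ≤ singularValues A i :=
  (Matrix.toEuclideanLin A).singularValues_nonneg i

lemma singularValues_antitone (A : Matrix m n 𝕜) : Antitone (singularValues A) :=
  (Matrix.toEuclideanLin A).singularValues_antitone

lemma singularValues_eq_zero_of_min_card_le (A : Matrix m n 𝕜) {i : ℕ}
    (hi : min (Fintype.card m) (Fintype.card n) ≤ i) : singularValues A i = 0 := by
  rw [LinearMap.singularValues_eq_zero_iff_le_finrank_range]
  refine (le_min ?_ ?_).trans hi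
  · simpa using Submodule.finrank_le (LinearMap.range (Matrix.toEuclideanLin A))
  · simpa using LinearMap.finrank_range_le (Matrix.toEuclideanLin A)

/-- An enumeration of the index type of a matrix along which the eigenvalues provided by
`Matrix.IsHermitian.eigenvalues` are decreasing. -/
noncomputable def eigenvalueIndex (n : Type*) [Fintype n] [DecidableEq n] :
    n ≃ Fin (Fintype.card n) :=
  (Fintype.equivOfCardEq (Fintype.card_fin _)).symm

lemma eigenvalues_conjTranspose_mul_self (A : Matrix m n 𝕜) (i : n) :
    (Matrix.isHermitian_conjTranspose_mul_self A).eigenvalues i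
      = singularValues A (eigenvalueIndex n i) ^ 2 := by
  classical
  have hgram : Matrix.toEuclideanLin (Aᴴ * A)
      = LinearMap.adjoint (Matrix.toEuclideanLin A) ∘ₗ Matrix.toEuclideanLin A := by
    rw [← Matrix.toEuclideanLin_conjTranspose_eq_adjoint]
    ext x i
    simp [Matrix.toLpLin_apply, Matrix.mulVec_mulVec]
  rw [(Matrix.toEuclideanLin A).sq_singularValues_fin finrank_euclideanSpace,
    Matrix.IsHermitian.eigenvalues, Matrix.IsHermitian.eigenvalues₀]
  congr!

lemma exists_unitary_cfc_conjTranspose_mul_self (A : Matrix m n 𝕜) :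
    ∃ U ∈ Matrix.unitaryGroup n 𝕜, ∀ f : ℝ → ℝ, cfc f (Aᴴ * A)
      = U * Matrix.diagonal
          (fun i => (f (singularValues A (eigenvalueIndex n i) ^ 2) : 𝕜)) * Uᴴ := by
  have hA := Matrix.isHermitian_conjTranspose_mul_self A
  refine ⟨hA.eigenvectorUnitary, hA.eigenvectorUnitary.2, fun f => ?_⟩
  simp only [hA.cfc_eq, Matrix.IsHermitian.cfc, Unitary.conjStarAlgAut_apply,
    ← eigenvalues_conjTranspose_mul_self]
  rfl

lemma exists_unitary_conjTranspose_mul_self (A : Matrix m n 𝕜) :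
    ∃ U ∈ Matrix.unitaryGroup n 𝕜, Aᴴ * A = U * Matrix.diagonal
      (fun i => ((singularValues A (eigenvalueIndex n i) ^ 2 : ℝ) : 𝕜)) * Uᴴ := by
  obtain ⟨U, hU, hcfc⟩ := exists_unitary_cfc_conjTranspose_mul_self A
  exact ⟨U, hU, (cfc_id' ℝ (Aᴴ * A) (Matrix.isHermitian_conjTranspose_mul_self A)).symm.trans
    (hcfc fun x => x)⟩

variable {κ : Type*} [Fintype κ] [DecidableEq κ]

lemma norm_det_conjTranspose_mul_self_mul_le (A : Matrix m n 𝕜) (V : Matrix n κ 𝕜) :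
    ‖((A * V)ᴴ * (A * V)).det‖
      ≤ (∏ i ∈ Finset.range (Fintype.card κ), singularValues A i ^ 2) * ‖(Vᴴ * V).det‖ := by
  obtain ⟨U, hU, hgram⟩ := exists_unitary_conjTranspose_mul_self A
  have hAV : (A * V)ᴴ * (A * V) = (Uᴴ * V)ᴴ * Matrix.diagonal
      (fun i => ((singularValues A (eigenvalueIndex n i) ^ 2 : ℝ) : 𝕜)) * (Uᴴ * V) := by
    rw [Matrix.conjTranspose_mul, Matrix.mul_assoc, ← Matrix.mul_assoc Aᴴ, hgram]
    simp only [Matrix.conjTranspose_mul, Matrix.conjTranspose_conjTranspose, Matrix.mul_assoc]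
  have hV : (Uᴴ * V)ᴴ * (Uᴴ * V) = Vᴴ * V := by
    rw [Matrix.conjTranspose_mul, Matrix.conjTranspose_conjTranspose, Matrix.mul_assoc,
      ← Matrix.mul_assoc U, ← Matrix.star_eq_conjTranspose U, Matrix.mem_unitaryGroup_iff.mp hU,
      Matrix.one_mul]
  rw [hAV, ← hV]
  exact norm_det_conjTranspose_mul_diagonal_mul_le
    (fun i j hij => pow_le_pow_left₀ (singularValues_nonneg A j) (singularValues_antitone A hij) 2)
    (fun i => sq_nonneg _) (Fin.val_injective.comp (eigenvalueIndex n).injective) (Uᴴ * V)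

lemma exists_isometry_conjTranspose_mul_self_eq_diagonal (A : Matrix m n 𝕜) {k : ℕ}
    (hk : k ≤ Fintype.card n) : ∃ V : Matrix n (Fin k) 𝕜, Vᴴ * V = 1 ∧
      (A * V)ᴴ * (A * V)
        = Matrix.diagonal (fun i : Fin k => ((singularValues A i ^ 2 : ℝ) : 𝕜)) := by
  obtain ⟨U, hU, hgram⟩ := exists_unitary_conjTranspose_mul_self A
  have hU' : Uᴴ * U = 1 := Matrix.mem_unitaryGroup_iff'.mp hU
  let g : Fin k → n := (eigenvalueIndex n).symm ∘ Fin.castLE hk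
  have hg : Function.Injective g :=
    (eigenvalueIndex n).symm.injective.comp (Fin.castLE_injective hk)
  refine ⟨U.submatrix id g, ?_, ?_⟩
  · rw [Matrix.conjTranspose_submatrix, ← Matrix.submatrix_mul _ _ _ _ _ Function.bijective_id,
      hU', Matrix.submatrix_one _ hg]
  · have hdiag : (A * U)ᴴ * (A * U) = Matrix.diagonal
        (fun i => ((singularValues A (eigenvalueIndex n i) ^ 2 : ℝ) : 𝕜)) := by
      rw [Matrix.conjTranspose_mul, Matrix.mul_assoc, ← Matrix.mul_assoc Aᴴ, hgram,
        Matrix.mul_assoc, hU', Matrix.mul_one, ← Matrix.mul_assoc, hU', Matrix.one_mul]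
    have hcols : A * U.submatrix id g = (A * U).submatrix id g := rfl
    rw [hcols, Matrix.conjTranspose_submatrix,
      ← Matrix.submatrix_mul _ _ _ _ _ Function.bijective_id, hdiag,
      Matrix.submatrix_diagonal _ _ hg]
    simp [g, Function.comp_def]

lemma prod_sq_singularValues_le_of_norm_det_le (A : Matrix m n 𝕜) {k : ℕ} {c : ℝ} (hc : 0 ≤ c)
    (h : ∀ V : Matrix n (Fin k) 𝕜, ‖((A * V)ᴴ * (A * V)).det‖ ≤ c * ‖(Vᴴ * V).det‖) :
    ∏ i ∈ Finset.range k, singularValues A i ^ 2 ≤ c := by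
  rcases le_or_gt k (Fintype.card n) with hk | hk
  · obtain ⟨V, hV, hAV⟩ := exists_isometry_conjTranspose_mul_self_eq_diagonal A hk
    have hdet := h V
    rw [hV, hAV, Matrix.det_one, norm_one, mul_one, Matrix.det_diagonal, ← RCLike.ofReal_prod,
      RCLike.norm_of_nonneg (Finset.prod_nonneg fun i _ => sq_nonneg _)] at hdet
    rwa [Finset.prod_range]
  · rwa [Finset.prod_eq_zero (Finset.mem_range.mpr hk)]
    rw [singularValues_eq_zero_of_min_card_le A (min_le_right _ _), zero_pow two_ne_zero]

end SingularValues

lemma norm_det_conjTranspose_mul_self_chainProd_mul_le {κ : Type*} [Fintype κ] [DecidableEq κ]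
    (L : ℕ) (d : Fin (L + 1) → ℕ)
    (A : (i : Fin L) → Matrix (Fin (d i.succ)) (Fin (d i.castSucc)) ℂ)
    (V : Matrix (Fin (d 0)) κ ℂ) :
    ‖((chainProd L d A * V)ᴴ * (chainProd L d A * V)).det‖
      ≤ (∏ j, ∏ i ∈ Finset.range (Fintype.card κ), singularValues (A j) i ^ 2)
        * ‖(Vᴴ * V).det‖ := by
  induction L with
  | zero => simp [chainProd]
  | succ L ih =>
    let B : Matrix _ (Fin (d 0)) ℂ := chainProd L (fun i => d i.castSucc) fun i => A i.castSucc
    have hfirst := ih (fun i => d i.castSucc) (fun i => A i.castSucc) V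
    have hlast := norm_det_conjTranspose_mul_self_mul_le (A (Fin.last L)) (B * V)
    rw [← Matrix.mul_assoc (A (Fin.last L)) B V] at hlast
    rw [Fin.prod_univ_castSucc, mul_comm (∏ j : Fin L, _), mul_assoc]
    exact hlast.trans (mul_le_mul_of_nonneg_left hfirst
      (Finset.prod_nonneg fun _ _ => sq_nonneg _))

lemma prod_singularValues_chainProd_le (L : ℕ) (d : Fin (L + 1) → ℕ)
    (A : (i : Fin L) → Matrix (Fin (d i.succ)) (Fin (d i.castSucc)) ℂ) (k : ℕ) :
    ∏ i ∈ Finset.range k, singularValues (chainProd L d A) i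
      ≤ ∏ i ∈ Finset.range k, ∏ j, singularValues (A j) i := by
  have hsq := prod_sq_singularValues_le_of_norm_det_le (chainProd L d A) (k := k)
    (Finset.prod_nonneg fun j _ => Finset.prod_nonneg fun i _ => sq_nonneg (singularValues (A j) i))
    fun V => by
      simpa only [Fintype.card_fin] using
        norm_det_conjTranspose_mul_self_chainProd_mul_le L d A V
  rw [Finset.prod_comm] at hsq
  simp only [Finset.prod_pow] at hsq
  exact le_of_sq_le_sq hsq
    (Finset.prod_nonneg fun _ _ => Finset.prod_nonneg fun _ _ => singularValues_nonneg _ _)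

section Majorization

lemma sum_mul_nonneg_of_antitone {n : ℕ} {f : Fin n → ℝ} (hf : Antitone f) (hf0 : ∀ i, 0 ≤ f i)
    {g : ℕ → ℝ} (hg : ∀ k ≤ n, 0 ≤ ∑ i ∈ Finset.range k, g i) : 0 ≤ ∑ i : Fin n, f i * g i := by
  induction n with
  | zero => simp
  | succ n ih =>
    have hinit := ih (f := fun i => f i.castSucc - f (Fin.last n))
      (fun i j hij => sub_le_sub_right (hf (Fin.castSucc_le_castSucc_iff.mpr hij)) _)
      (fun i => sub_nonneg.mpr (hf (Fin.le_last _))) fun k hk => hg k (hk.trans n.le_succ)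
    calc 0 ≤ ∑ i : Fin n, (f i.castSucc - f (Fin.last n)) * g i
          + f (Fin.last n) * ∑ i ∈ Finset.range (n + 1), g i :=
        add_nonneg hinit (mul_nonneg (hf0 _) (hg _ le_rfl))
      _ = ∑ i : Fin (n + 1), f i * g i := by
        rw [Fin.sum_univ_castSucc, Finset.sum_range_succ, Finset.sum_range, mul_add,
          Finset.mul_sum, ← add_assoc, ← Finset.sum_add_distrib]
        simp [sub_mul]

lemma card_le_sum_of_one_le_prod {ι : Type*} {s : Finset ι} {t : ι → ℝ} (ht : ∀ i ∈ s, 0 ≤ t i)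
    (hprod : 1 ≤ ∏ i ∈ s, t i) : (s.card : ℝ) ≤ ∑ i ∈ s, t i := by
  have hne : ∀ i ∈ s, t i ≠ 0 := Finset.prod_ne_zero_iff.mp (zero_lt_one.trans_le hprod).ne'
  have hlog : 0 ≤ ∑ i ∈ s, Real.log (t i) := by
    rw [← Real.log_prod hne]
    exact Real.log_nonneg hprod
  have hle : ∑ i ∈ s, Real.log (t i) ≤ ∑ i ∈ s, (t i - 1) := Finset.sum_le_sum fun i hi =>
    Real.log_le_sub_one_of_pos ((ht i hi).lt_of_ne' (hne i hi))
  simpa using hlog.trans hle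

lemma sum_mul_le_sum_mul_of_prod_le_of_pos {n : ℕ} {w : Fin n → ℝ} {x y : ℕ → ℝ}
    (hw : Antitone w) (hw0 : ∀ i, 0 ≤ w i) (hx : Antitone x) (hx0 : ∀ i < n, 0 < x i)
    (hy0 : ∀ i, 0 ≤ y i)
    (h : ∀ k ≤ n, ∏ i ∈ Finset.range k, x i ≤ ∏ i ∈ Finset.range k, y i) :
    ∑ i : Fin n, w i * x i ≤ ∑ i : Fin n, w i * y i := by
  have hg (k : ℕ) (hk : k ≤ n) : 0 ≤ ∑ i ∈ Finset.range k, (y i / x i - 1) := by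
    have hpos : ∀ i ∈ Finset.range k, 0 < x i := fun i hi =>
      hx0 i ((Finset.mem_range.mp hi).trans_le hk)
    have hone : 1 ≤ ∏ i ∈ Finset.range k, y i / x i := by
      rw [Finset.prod_div_distrib, one_le_div (Finset.prod_pos hpos)]
      exact h k hk
    simpa using card_le_sum_of_one_le_prod (fun i hi => div_nonneg (hy0 i) (hpos i hi).le) hone
  have hf : Antitone fun i : Fin n => w i * x i := fun i j hij =>
    mul_le_mul (hw hij) (hx hij) (hx0 j j.2).le (hw0 i)
  have hsum := sum_mul_nonneg_of_antitone hf (fun i => mul_nonneg (hw0 i) (hx0 i i.2).le) hg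
  rw [← sub_nonneg, ← Finset.sum_sub_distrib]
  refine hsum.trans_eq (Finset.sum_congr rfl fun i _ => ?_)
  have := (hx0 i i.2).ne'
  field_simp

lemma sum_mul_le_sum_mul_of_prod_le {n : ℕ} {w : Fin n → ℝ} {x y : ℕ → ℝ}
    (hw : Antitone w) (hw0 : ∀ i, 0 ≤ w i) (hx : Antitone x) (hx0 : ∀ i, 0 ≤ x i)
    (hy0 : ∀ i, 0 ≤ y i)
    (h : ∀ k ≤ n, ∏ i ∈ Finset.range k, x i ≤ ∏ i ∈ Finset.range k, y i) :
    ∑ i : Fin n, w i * x i ≤ ∑ i : Fin n, w i * y i := by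
  induction n with
  | zero => simp
  | succ n ih =>
    rcases (hx0 n).eq_or_lt' with hn | hn
    · have hinit := ih (w := fun i => w i.castSucc)
        (fun i j hij => hw (Fin.castSucc_le_castSucc_iff.mpr hij)) (fun i => hw0 _)
        fun k hk => h k (hk.trans n.le_succ)
      simp only [Fin.sum_univ_castSucc, Fin.val_castSucc, Fin.val_last, hn, mul_zero]
      exact add_le_add hinit (mul_nonneg (hw0 _) (hy0 n))
    · exact sum_mul_le_sum_mul_of_prod_le_of_pos hw hw0 hx
        (fun i hi => hn.trans_le (hx (Nat.le_of_lt_succ hi))) hy0 h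

end Majorization

section Gauge

lemma exists_dual_eq_seminorm {𝕜 E : Type*} [RCLike 𝕜] [AddCommGroup E] [Module 𝕜 E]
    (p : Seminorm 𝕜 E) (x : E) :
    ∃ f : Module.Dual 𝕜 E, f x = (p x : 𝕜) ∧ ∀ y, ‖f y‖ ≤ p y := by
  let g : E →ₗ.[𝕜] 𝕜 := LinearPMap.mkSpanSingleton' x (p x : 𝕜) fun c hc => by
    have hpc : ‖c‖ * p x = 0 := by rw [← map_smul_eq_mul, hc, map_zero]
    rcases mul_eq_zero.mp hpc with h | h
    · simp [norm_eq_zero.mp h]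
    · simp [h]
  have hg (y : g.domain) : ‖g y‖ ≤ p y := by
    obtain ⟨y, hy⟩ := y
    obtain ⟨c, rfl⟩ := Submodule.mem_span_singleton.mp hy
    simp only [g, LinearPMap.mkSpanSingleton'_apply]
    simp [map_smul_eq_mul, abs_of_nonneg (apply_nonneg p x)]
  obtain ⟨f, hfg, hf⟩ := Module.Dual.exists_extension_of_le_seminorm g.domain g.toFun hg
  refine ⟨f, ?_, hf⟩
  exact (hfg ⟨x, Submodule.mem_span_singleton_self x⟩).trans
    (LinearPMap.mkSpanSingleton'_apply_self _ _ _ _)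

/-- A seminorm on `ℝ^ι` depending only on the absolute values of the coordinates. -/
structure IsAbsolute {ι : Type*} (Φ : Seminorm ℝ (ι → ℝ)) : Prop where
  map_abs : ∀ x, Φ |x| = Φ x

/-- A symmetric gauge function: an absolute seminorm on `ℝ^ι` invariant under permutations of the
coordinates. Definiteness is not required. -/
structure IsSymmetricGauge {ι : Type*} (Φ : Seminorm ℝ (ι → ℝ)) : Prop extends IsAbsolute Φ where
  map_perm : ∀ (σ : Equiv.Perm ι) (x), Φ (x ∘ σ) = Φ x

variable {ι : Type*} {Φ : Seminorm ℝ (ι → ℝ)}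

lemma IsAbsolute.exists_weights [Fintype ι] (hΦ : IsAbsolute Φ) (x : ι → ℝ) :
    ∃ w : ι → ℝ, (∀ i, 0 ≤ w i) ∧ Φ x ≤ ∑ i, w i * |x i| ∧ ∀ y, ∑ i, w i * |y i| ≤ Φ y := by
  classical
  obtain ⟨f, hfx, hf⟩ := exists_dual_eq_seminorm Φ x
  let c : ι → ℝ := fun i => f fun j => if i = j then 1 else 0
  have hfc (y : ι → ℝ) : f y = ∑ i, y i * c i := LinearMap.pi_apply_eq_sum_univ f y
  refine ⟨fun i => |c i|, fun i => abs_nonneg _, ?_, fun y => ?_⟩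
  · calc Φ x = ∑ i, x i * c i := by rw [← hfc, hfx, RCLike.ofReal_real_eq_id, id]
      _ ≤ ∑ i, |c i| * |x i| := Finset.sum_le_sum fun i _ => by
        rw [← abs_mul, mul_comm]
        exact le_abs_self _
  · let z : ι → ℝ := fun i => if 0 ≤ c i then |y i| else -|y i|
    have hz : |z| = |y| := by
      ext i
      by_cases hi : 0 ≤ c i <;> simp [z, hi]
    calc ∑ i, |c i| * |y i| = ∑ i, z i * c i := Finset.sum_congr rfl fun i _ => by
          by_cases hi : 0 ≤ c i
          · simp [z, hi, abs_of_nonneg hi, mul_comm]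
          · simp [z, hi, abs_of_neg (not_le.mp hi), mul_comm]
      _ ≤ ‖f z‖ := by
        rw [← hfc]
        exact le_abs_self _
      _ ≤ Φ z := hf z
      _ = Φ y := by rw [← hΦ.map_abs, hz, hΦ.map_abs]

lemma IsAbsolute.mono [Finite ι] (hΦ : IsAbsolute Φ) {x y : ι → ℝ} (hxy : ∀ i, |x i| ≤ |y i|) :
    Φ x ≤ Φ y := by
  cases nonempty_fintype ι
  obtain ⟨w, hw, hx, hy⟩ := hΦ.exists_weights x
  calc Φ x ≤ ∑ i, w i * |x i| := hx
    _ ≤ ∑ i, w i * |y i| :=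
      Finset.sum_le_sum fun i _ => mul_le_mul_of_nonneg_left (hxy i) (hw i)
    _ ≤ Φ y := hy y

section Holder

variable [Finite ι] {J : Type*} [Fintype J] {w : J → ℝ} {z : J → ι → ℝ}

lemma IsAbsolute.map_prod_rpow_le_of_forall_le (hΦ : IsAbsolute Φ) (hw : ∀ j, 0 ≤ w j)
    (hw1 : ∑ j, w j = 1) (hz : ∀ j i, 0 ≤ z j i) {t : J → ℝ} (ht : ∀ j, 0 < t j)
    (hzt : ∀ j, Φ (z j) ≤ t j) :
    Φ (fun i => ∏ j, z j i ^ w j) ≤ ∏ j, t j ^ w j := by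
  have hT : 0 ≤ ∏ j, t j ^ w j := Finset.prod_nonneg fun j _ => Real.rpow_nonneg (ht j).le _
  have hpointwise (i : ι) :
      ∏ j, z j i ^ w j ≤ ((∏ j, t j ^ w j) • ∑ j, (w j / t j) • z j) i := by
    calc ∏ j, z j i ^ w j = (∏ j, t j ^ w j) * ∏ j, (z j i / t j) ^ w j := by
          rw [← Finset.prod_mul_distrib]
          refine Finset.prod_congr rfl fun j _ => ?_
          rw [← Real.mul_rpow (ht j).le (div_nonneg (hz j i) (ht j).le),
            mul_div_cancel₀ _ (ht j).ne']
      _ ≤ (∏ j, t j ^ w j) * ∑ j, w j * (z j i / t j) :=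
        mul_le_mul_of_nonneg_left (Real.geom_mean_le_arith_mean_weighted _ _ _
          (fun j _ => hw j) hw1 fun j _ => div_nonneg (hz j i) (ht j).le) hT
      _ = ((∏ j, t j ^ w j) • ∑ j, (w j / t j) • z j) i := by
        simp [mul_div_assoc', div_mul_eq_mul_div]
  calc Φ (fun i => ∏ j, z j i ^ w j)
      ≤ Φ ((∏ j, t j ^ w j) • ∑ j, (w j / t j) • z j) :=
        hΦ.mono fun i => abs_le_abs_of_nonneg
          (Finset.prod_nonneg fun j _ => Real.rpow_nonneg (hz j i) _) (hpointwise i)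
    _ = (∏ j, t j ^ w j) * Φ (∑ j, (w j / t j) • z j) := by
        rw [map_smul_eq_mul, Real.norm_of_nonneg hT]
    _ ≤ (∏ j, t j ^ w j) * ∑ j, w j := by
        refine mul_le_mul_of_nonneg_left ?_ hT
        refine (Finset.le_sum_of_subadditive Φ (map_zero Φ).le (map_add_le_add Φ) _ _).trans
          (Finset.sum_le_sum fun j _ => ?_)
        rw [map_smul_eq_mul, Real.norm_of_nonneg (div_nonneg (hw j) (ht j).le)]
        exact (mul_le_mul_of_nonneg_left (hzt j) (div_nonneg (hw j) (ht j).le)).trans_eq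
          (div_mul_cancel₀ _ (ht j).ne')
    _ = ∏ j, t j ^ w j := by rw [hw1, mul_one]

lemma IsAbsolute.map_prod_rpow_le (hΦ : IsAbsolute Φ) (hw : ∀ j, 0 ≤ w j)
    (hw1 : ∑ j, w j = 1) (hz : ∀ j i, 0 ≤ z j i) :
    Φ (fun i => ∏ j, z j i ^ w j) ≤ ∏ j, Φ (z j) ^ w j := by
  -- Some `Φ (z j)` may vanish, so they are replaced by `Φ (z j) + ε` before normalising.
  have hlim : Filter.Tendsto (fun ε : ℝ => ∏ j, (Φ (z j) + ε) ^ w j) (nhdsWithin 0 (Set.Ioi 0))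
      (nhds (∏ j, Φ (z j) ^ w j)) := by
    have hcont : Continuous fun ε : ℝ => ∏ j, (Φ (z j) + ε) ^ w j :=
      continuous_finsetProd _ fun j _ =>
        (continuous_const.add continuous_id).rpow_const fun _ => Or.inr (hw j)
    simpa using (hcont.tendsto 0).mono_left nhdsWithin_le_nhds
  refine ge_of_tendsto hlim (eventually_nhdsWithin_of_forall fun ε hε => ?_)
  exact hΦ.map_prod_rpow_le_of_forall_le hw hw1 hz
    (fun j => add_pos_of_nonneg_of_pos (apply_nonneg Φ _) hε)
    fun j => le_add_of_nonneg_right (le_of_lt hε)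

end Holder

lemma IsSymmetricGauge.le_of_prod_le {n : ℕ} {Φ : Seminorm ℝ (Fin n → ℝ)}
    (hΦ : IsSymmetricGauge Φ) {x y : ℕ → ℝ} (hx : Antitone x) (hx0 : ∀ i, 0 ≤ x i)
    (hy0 : ∀ i, 0 ≤ y i)
    (h : ∀ k ≤ n, ∏ i ∈ Finset.range k, x i ≤ ∏ i ∈ Finset.range k, y i) :
    Φ (fun i => x i) ≤ Φ (fun i => y i) := by
  obtain ⟨w, hw0, hwx, hwy⟩ := hΦ.exists_weights fun i : Fin n => x i
  let τ := Tuple.sort fun i => -w i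
  have hτ : Antitone (w ∘ τ) := fun i j hij =>
    neg_le_neg_iff.mp (Tuple.monotone_sort (fun i => -w i) hij)
  calc Φ (fun i => x i) ≤ ∑ i, w i * x i := by simpa only [abs_of_nonneg (hx0 _)] using hwx
    _ ≤ ∑ i, (w ∘ τ) i * x i := by
        have hmono : Monovary (w ∘ τ) fun i : Fin n => x i := hτ.monovary fun i j hij => hx hij
        simpa using hmono.sum_comp_perm_mul_le_sum_mul (σ := τ.symm)
    _ ≤ ∑ i, (w ∘ τ) i * y i :=
        sum_mul_le_sum_mul_of_prod_le hτ (fun i => hw0 _) hx hx0 hy0 h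
    _ = ∑ i, w i * |y (τ.symm i)| := by
        rw [← Equiv.sum_comp τ fun i => w i * |y (τ.symm i)|]
        simp [abs_of_nonneg (hy0 _)]
    _ ≤ Φ ((fun i : Fin n => y i) ∘ τ.symm) := hwy _
    _ = Φ (fun i => y i) := hΦ.map_perm _ _

section Chain

variable {n L : ℕ} {Φ : Seminorm ℝ (Fin n → ℝ)} {d : Fin (L + 1) → ℕ}
  (A : (i : Fin L) → Matrix (Fin (d i.succ)) (Fin (d i.castSucc)) ℂ)

lemma IsSymmetricGauge.map_singularValues_chainProd_rpow_le (hΦ : IsSymmetricGauge Φ) {r : ℝ}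
    (hr : 0 ≤ r) :
    Φ (fun i => singularValues (chainProd L d A) i ^ r)
      ≤ Φ fun i => ∏ j, singularValues (A j) i ^ r := by
  have hs (j : Fin L) (i : ℕ) : 0 ≤ singularValues (A j) i := singularValues_nonneg _ _
  refine hΦ.le_of_prod_le (x := fun i => singularValues (chainProd L d A) i ^ r)
    (y := fun i => ∏ j, singularValues (A j) i ^ r)
    (fun i j hij => Real.rpow_le_rpow (singularValues_nonneg _ _)
      (singularValues_antitone _ hij) hr)
    (fun i => Real.rpow_nonneg (singularValues_nonneg _ _) _)
    (fun i => Finset.prod_nonneg fun j _ => Real.rpow_nonneg (hs j i) _) fun k _ => ?_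
  simp only [Real.finsetProd_rpow _ _ fun j _ => hs j _]
  rw [Real.finsetProd_rpow _ _ fun i _ => singularValues_nonneg _ _,
    Real.finsetProd_rpow _ _ fun i _ => Finset.prod_nonneg fun j _ => hs j i]
  exact Real.rpow_le_rpow (Finset.prod_nonneg fun _ _ => singularValues_nonneg _ _)
    (prod_singularValues_chainProd_le L d A k) hr

lemma IsSymmetricGauge.map_singularValues_chainProd_rpow_one_div_le (hΦ : IsSymmetricGauge Φ)
    {p : Fin L → ℝ} {r : ℝ} (hp : ∀ i, 0 < p i) (hr : 0 < r) (hsum : ∑ i, 1 / p i = 1 / r) :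
    Φ (fun i => singularValues (chainProd L d A) i ^ r) ^ (1 / r)
      ≤ ∏ j, Φ (fun i => singularValues (A j) i ^ p j) ^ (1 / p j) := by
  have hw : ∑ j, r / p j = 1 := by
    simp only [div_eq_mul_one_div r]
    rw [← Finset.mul_sum, hsum, mul_one_div_cancel hr.ne']
  have hpow (j : Fin L) (i : ℕ) :
      (singularValues (A j) i ^ p j) ^ (r / p j) = singularValues (A j) i ^ r := by
    rw [← Real.rpow_mul (singularValues_nonneg _ _), mul_div_cancel₀ _ (hp j).ne']
  have hholder := hΦ.map_prod_rpow_le (fun j => (div_pos hr (hp j)).le) hw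
    (z := fun j (i : Fin n) => singularValues (A j) i ^ p j)
    fun j i => Real.rpow_nonneg (singularValues_nonneg _ _) _
  simp only [hpow] at hholder
  calc Φ (fun i => singularValues (chainProd L d A) i ^ r) ^ (1 / r)
      ≤ (∏ j, Φ (fun i => singularValues (A j) i ^ p j) ^ (r / p j)) ^ (1 / r) :=
        Real.rpow_le_rpow (apply_nonneg Φ _)
          ((hΦ.map_singularValues_chainProd_rpow_le A hr.le).trans hholder) (one_div_pos.mpr hr).le
    _ = ∏ j, Φ (fun i => singularValues (A j) i ^ p j) ^ (1 / p j) := by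
        rw [← Real.finsetProd_rpow _ _ fun j _ => Real.rpow_nonneg (apply_nonneg Φ _) _]
        refine Finset.prod_congr rfl fun j _ => ?_
        rw [← Real.rpow_mul (apply_nonneg Φ _)]
        congr 1
        have := (hp j).ne'
        field_simp

end Chain

end Gauge

section NormFamily

/-- The `ℓ¹` norm as a seminorm on `ℝ^ι`: the gauge of the Schatten quasi-norms. -/
noncomputable def l1Seminorm (ι : Type*) [Fintype ι] : Seminorm ℝ (ι → ℝ) :=
  Seminorm.of (fun x => ∑ i, |x i|)
    (fun x y => by
      rw [← Finset.sum_add_distrib]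
      exact Finset.sum_le_sum fun i _ => abs_add_le _ _)
    fun c x => by simp [abs_mul, Finset.mul_sum]

lemma isSymmetricGauge_l1Seminorm (ι : Type*) [Fintype ι] : IsSymmetricGauge (l1Seminorm ι) where
  map_abs x := Finset.sum_congr rfl fun i _ => abs_abs (x i)
  map_perm σ x := Equiv.sum_comp σ fun i => |x i|

variable {N : MatrixFunctionFamily}

/-- The restriction of a compatible norm family to real diagonal `n × n` matrices, as a seminorm of
the diagonal: the gauge of a unitarily invariant family. -/
noncomputable def diagonalSeminorm (hN : IsCompatibleNormFamily N) (n : ℕ) :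
    Seminorm ℝ (Fin n → ℝ) :=
  Seminorm.of (fun x => N n n (Matrix.diagonal fun i => (x i : ℂ)))
    (fun x y => by
      refine le_of_eq_of_le ?_ (hN.add_le n n _ _)
      rw [Matrix.diagonal_add]
      simp)
    fun c x => by
      rw [← Complex.norm_real, ← hN.smul, ← Matrix.diagonal_smul]
      simp [Pi.smul_def]

lemma IsUnitaryInvariant.map_conj (hU : IsUnitaryInvariant N) {n : ℕ}
    {U : Matrix (Fin n) (Fin n) ℂ} (hUm : U ∈ Matrix.unitaryGroup (Fin n) ℂ)
    (M : Matrix (Fin n) (Fin n) ℂ) : N n n (U * M * Uᴴ) = N n n M := by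
  simpa only [Matrix.transpose_transpose] using
    hU n n M U Uᴴᵀ hUm (Matrix.transpose_mem_unitaryGroup_iff.mpr (Unitary.star_mem hUm))

lemma IsUnitaryInvariant.isSymmetricGauge_diagonalSeminorm (hU : IsUnitaryInvariant N)
    (hN : IsCompatibleNormFamily N) (n : ℕ) : IsSymmetricGauge (diagonalSeminorm hN n) where
  map_abs x := by
    let ε : Fin n → ℂ := fun i => if 0 ≤ x i then 1 else -1
    have hε : Matrix.diagonal ε ∈ Matrix.unitaryGroup (Fin n) ℂ := by
      rw [Matrix.mem_unitaryGroup_iff, Matrix.star_eq_conjTranspose, Matrix.diagonal_conjTranspose,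
        Matrix.diagonal_mul_diagonal, ← Matrix.diagonal_one]
      congr 1
      funext i
      by_cases hi : 0 ≤ x i <;> simp [ε, hi]
    refine Eq.trans ?_ (hU n n (Matrix.diagonal fun i => (x i : ℂ)) _ 1 hε (one_mem _))
    rw [Matrix.transpose_one, Matrix.mul_one, Matrix.diagonal_mul_diagonal]
    change N n n _ = _
    congr 2
    funext i
    by_cases hi : 0 ≤ x i
    · simp [ε, hi, abs_of_nonneg hi]
    · simp [ε, hi, abs_of_neg (not_le.mp hi)]
  map_perm σ x := by
    have hσ : σ.permMatrix ℂ ∈ Matrix.unitaryGroup (Fin n) ℂ := by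
      rw [Matrix.mem_unitaryGroup_iff, Matrix.star_eq_conjTranspose,
        Matrix.conjTranspose_permMatrix, ← Matrix.permMatrix_mul]
      simp
    refine Eq.trans ?_ (hU.map_conj hσ (Matrix.diagonal fun i => (x i : ℂ)))
    rw [Matrix.conjTranspose_permMatrix, PEquiv.toMatrix_toPEquiv_mul,
      PEquiv.mul_toMatrix_toPEquiv]
    change N n n _ = _
    congr 1
    ext i j
    simp [Matrix.diagonal_apply, Equiv.Perm.inv_def]

open scoped ComplexOrder in
lemma polarPow_eq_cfc {m n : ℕ} (A : Matrix (Fin m) (Fin n) ℂ) {p : ℝ} (hp : 0 ≤ p) :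
    polarPow A p = cfc (fun x : ℝ => x ^ (p / 2)) (Aᴴ * A) := by
  have hA : 0 ≤ Aᴴ * A := (Matrix.posSemidef_conjTranspose_mul_self A).nonneg
  rw [← CFC.rpow_eq_cfc_real hA, polarPow, polarPart, CFC.sqrt_eq_rpow]
  change ((Aᴴ * A) ^ (1 / 2 : ℝ)) ^ p = _
  rw [CFC.rpow_rpow_of_exponent_nonneg _ _ _ (by norm_num) hp hA, one_div_mul_eq_div]

lemma blockIncl_diagonal {n l : ℕ} {x : ℕ → ℂ} (hx : ∀ i, n ≤ i → x i = 0) :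
    blockIncl l l (Matrix.diagonal fun i : Fin n => x i)
      = Matrix.diagonal fun i : Fin l => x i := by
  ext i j
  rcases eq_or_ne i j with rfl | hij
  · by_cases hi : (i : ℕ) < n
    · simp [blockIncl, hi]
    · simp [blockIncl, hi, hx i (not_lt.mp hi)]
  · simp [blockIncl, Matrix.diagonal_apply, hij, Fin.val_ne_of_ne hij]

variable {m n l : ℕ} {p : ℝ}

lemma singularValues_rpow_eq_zero (A : Matrix (Fin m) (Fin n) ℂ) (hp : 0 < p) {i : ℕ}
    (hi : min m n ≤ i) : singularValues A i ^ p = 0 := by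
  rw [singularValues_eq_zero_of_min_card_le A (by simpa using hi), Real.zero_rpow hp.ne']

lemma IsUnitaryInvariant.map_polarPow (hU : IsUnitaryInvariant N) (hN : IsCompatibleNormFamily N)
    (hl : n ≤ l) (A : Matrix (Fin m) (Fin n) ℂ) (hp : 0 < p) :
    N n n (polarPow A p) = diagonalSeminorm hN l fun i => singularValues A i ^ p := by
  obtain ⟨U, hUm, hcfc⟩ := exists_unitary_cfc_conjTranspose_mul_self A
  let σ : Equiv.Perm (Fin n) := (eigenvalueIndex (Fin n)).trans (finCongr (Fintype.card_fin n))
  have hpow (i : ℕ) : (singularValues A i ^ 2) ^ (p / 2) = singularValues A i ^ p := by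
    rw [← Real.rpow_natCast_mul (singularValues_nonneg A i), Nat.cast_ofNat,
      mul_div_cancel₀ _ two_ne_zero]
  calc N n n (polarPow A p)
      = diagonalSeminorm hN n ((fun i : Fin n => singularValues A i ^ p) ∘ σ) := by
        rw [polarPow_eq_cfc A hp.le, hcfc, hU.map_conj hUm]
        simp only [hpow]
        rfl
    _ = diagonalSeminorm hN n fun i => singularValues A i ^ p :=
        (hU.isSymmetricGauge_diagonalSeminorm hN n).map_perm σ _
    _ = diagonalSeminorm hN l fun i => singularValues A i ^ p := by
        have hpad := blockIncl_diagonal (n := n) (l := l)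
          (x := fun i => ((singularValues A i ^ p : ℝ) : ℂ)) fun i hi => by
            rw [singularValues_rpow_eq_zero A hp ((min_le_right m n).trans hi), Complex.ofReal_zero]
        exact (hN.blockIncl_eq n n l l _ hl hl).symm.trans (congrArg (N l l) hpad)

lemma schattenNorm_eq_l1Seminorm (hl : n ≤ l) (A : Matrix (Fin m) (Fin n) ℂ) (hp : 0 < p) :
    schattenNorm p A = l1Seminorm (Fin l) (fun i => singularValues A i ^ p) ^ (1 / p) := by
  have hsum : ∑ i ∈ Finset.range (min m n), singularValues A i ^ p
      = ∑ i ∈ Finset.range l, singularValues A i ^ p :=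
    Finset.sum_subset (Finset.range_mono ((min_le_right m n).trans hl)) fun i _ hi =>
      singularValues_rpow_eq_zero A hp (not_lt.mp fun h => hi (Finset.mem_range.mpr h))
  have habs (i : ℕ) : |singularValues A i ^ p| = singularValues A i ^ p :=
    abs_of_nonneg (Real.rpow_nonneg (singularValues_nonneg A i) p)
  rw [schattenNorm, hsum, Finset.sum_range]
  change _ = (∑ i : Fin l, |singularValues A i ^ p|) ^ (1 / p)
  simp only [habs]

end NormFamily

end MatrixHolder

theorem mainTheorem2 (L : ℕ) (d : Fin (L + 1) → ℕ)
    (A : (i : Fin L) → Matrix (Fin (d i.succ)) (Fin (d i.castSucc)) ℂ)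
    (B : Matrix (Fin (d (Fin.last L))) (Fin (d 0)) ℂ)
    (hB : MatrixHolder.chainProd L d A = B)
    (p : Fin L → ℝ) (r : ℝ) (hp : ∀ i, 0 < p i) (hr : 0 < r)
    (hsum : ∑ i, 1 / p i = 1 / r) :
    (∀ N : MatrixHolder.MatrixFunctionFamily,
      MatrixHolder.IsCompatibleNormFamily N → MatrixHolder.IsUnitaryInvariant N →
        N (d 0) (d 0) (MatrixHolder.polarPow B r) ^ (1 / r) ≤
          ∏ i, N (d i.castSucc) (d i.castSucc) (MatrixHolder.polarPow (A i) (p i)) ^ (1 / p i)) ∧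
    MatrixHolder.schattenNorm r B ≤ ∏ i, MatrixHolder.schattenNorm (p i) (A i) := by
  subst hB
  have hd (i : Fin (L + 1)) : d i ≤ ∑ j, d j :=
    Finset.single_le_sum (fun _ _ => Nat.zero_le _) (Finset.mem_univ i)
  constructor
  · intro N hN hU
    simp only [hU.map_polarPow hN (hd _) _ hr, hU.map_polarPow hN (hd _) _ (hp _)]
    exact (hU.isSymmetricGauge_diagonalSeminorm hN _).map_singularValues_chainProd_rpow_one_div_le
      A hp hr hsum
  · simp only [MatrixHolder.schattenNorm_eq_l1Seminorm (hd _) _ hr,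
      MatrixHolder.schattenNorm_eq_l1Seminorm (hd _) _ (hp _)]
    exact (MatrixHolder.isSymmetricGauge_l1Seminorm _).map_singularValues_chainProd_rpow_one_div_le
      A hp hr hsum
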